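/- Let $D\subset\mathbb R^2$ be a bounded domain of class $C^{1,1}$ and let $E\subset D$ be a domain with $\operatorname{dist}(\overline E,\partial D)>0$ (a domain is a nonempty connected open set). Let $$\mathcal F_s:=\{g\in C^2(\overline D):\ g(x)<0\ \ \forall x\in E,\quad |\nabla g(x)|+|g(x)|>0\ \ \forall x\in D,\quad g(x)>0\ \ \forall x\in\partial D\},$$ where $C^2(\overline D)$ is the set of continuous functions on $\overline D$ that are twice continuously differentiable in $D$ and whose derivatives of order at most two extend continuously to $\overline D$. For $g\in\mathcal F_s$ put $\Omega_g:=\operatorname{int}\{x\in D:\ g(x)\le 0\}$, and let $$\mathcal O:=\{\text{the connected component of }\Omega_g\text{ that contains }E:\ g\in\mathcal F_s\}.$$ Then $$\mathcal O=\{\Omega\subset D:\ \Omega\text{ is a domain of class }C^2,\ E\subset\Omega,\ \partial\Omega\cap\partial D=\emptyset\}.$$ A domain is of class $C^2$ (respectively $C^{1,1}$) if every point of its boundary has an open neighbourhood $U$ and a homeomorphism $\Phi$ of $U$ onto an open subset of $\mathbb R^2$ such that $\Phi$ and $\Phi^{-1}$ are of class $C^2$ (respectively of class $C^1$ with Lipschitz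 continuous derivative) and, within $U$, the domain is exactly $\{\Phi_2>0\}$ and its boundary is exactly $\{\Phi_2=0\}$. -/

import Mathlib

/-- The Euclidean plane `ℝ²`. -/
abbrev Plane : Type := EuclideanSpace ℝ (Fin 2)

/-- A domain: a nonempty, connected, open subset of the plane. -/
def IsDomainSet (U : Set Plane) : Prop :=
  IsOpen U ∧ IsConnected U

/-- The boundary of `U` can be flattened near each of its points by a homeomorphism `e` between
open sets of the plane that has regularity `R` together with its inverse. It maps the part of `U`
in its source to the part of the target in the upper half plane, and the part of the boundary
of `U` to the part of the target on the line bounding that half plane.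
Here `R V f` reads: `f` has the given regularity on the open set `V`. -/
def HasBoundaryOfClass (R : Set Plane → (Plane → Plane) → Prop) (U : Set Plane) : Prop :=
  ∀ x ∈ frontier U, ∃ e : OpenPartialHomeomorph Plane Plane,
    x ∈ e.source ∧ R e.source e ∧ R e.target e.symm ∧
    (∀ y ∈ e.source, y ∈ U ↔ 0 < e y 1) ∧
    (∀ y ∈ e.source, y ∈ frontier U ↔ e y 1 = 0)

/-- Domains of class `C²`. -/
def IsC2Domain (U : Set Plane) : Prop :=
  IsDomainSet U ∧ HasBoundaryOfClass (fun V f => ContDiffOn ℝ 2 f V) U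

/-- Domains of class `C^{1,1}`: the flattening maps are continuously differentiable with
Lipschitz continuous derivative. -/
def IsC11Domain (U : Set Plane) : Prop :=
  IsDomainSet U ∧ HasBoundaryOfClass
    (fun V f => ContDiffOn ℝ 1 f V ∧ ∃ K : NNReal, LipschitzOnWith K (fderiv ℝ f) V) U

/-- `g ∈ C²(closure D)` for an open set `D`: `g` is continuous on the closure of `D` and twice
continuously differentiable in `D`, and its derivatives of order at most two extend continuously
from `D` to the closure of `D`. Only the values of `g` on the closure of `D` matter. -/
def IsC2OnClosure (D : Set Plane) (g : Plane → ℝ) : Prop :=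
  ContinuousOn g (closure D) ∧ ContDiffOn ℝ 2 g D ∧
    ∀ k : ℕ, k ≤ 2 → ∃ F : Plane → Plane [×k]→L[ℝ] ℝ,
      ContinuousOn F (closure D) ∧ Set.EqOn F (iteratedFDeriv ℝ k g) D

/-- The set `F_s` of admissible shape functions. -/
def admissibleShapeFunctions (D E : Set Plane) : Set (Plane → ℝ) :=
  {g | IsC2OnClosure D g ∧ (∀ x ∈ E, g x < 0) ∧
    (∀ x ∈ D, 0 < ‖gradient g x‖ + |g x|) ∧ (∀ x ∈ frontier D, 0 < g x)}

/-- The open set `Ω_g = int {x ∈ D : g x ≤ 0}`. -/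
def shapeSet (D : Set Plane) (g : Plane → ℝ) : Set Plane :=
  interior {x | x ∈ D ∧ g x ≤ 0}

/-- `C` is a connected component of the set `S`. -/
def IsComponentOf (C S : Set Plane) : Prop :=
  ∃ x ∈ S, C = connectedComponentIn S x

/-- The set `O` of admissible domains: the components containing `E` of the sets `Ω_g`, where `g`
ranges over the admissible shape functions. -/
def admissibleDomains (D E : Set Plane) : Set (Set Plane) :=
  {Ω | ∃ g ∈ admissibleShapeFunctions D E, IsComponentOf Ω (shapeSet D g) ∧ E ⊆ Ω}

/-! A boundary point of a component of `Ω_g` is a zero of `g`, and `g > 0` on the boundary of `D`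
forces it into `D`. There the gradient is nonzero, so `-g` is the second coordinate of a `C²` chart
(`exists_flattening`). If the chart has convex image, the part `g < 0` is connected, hence lies in a
single component; this makes the component a `C²` domain (`isC2Domain_component_shapeSet`).

Conversely, a `C²` domain has local defining functions: minus the second chart coordinate at the
boundary, and the constants `-1` inside and `1` outside. A partition of unity glues them
(`exists_isDefiningOn_univ`): signs survive convex combinations, and the derivative stays nonzero
because all local functions increase in the same outward directions. For the glued `g`, `Ω_g` is the
given domain, which is its own component. -/

open Set Filter Topology
open scoped Manifold ContDiff

/-- On the open set `V`, `f` is a `C²` defining function of `Ω`: it is negative in `Ω`, positive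
off the closure of `Ω`, and vanishes with nonzero derivative on the boundary of `Ω`. -/
structure IsDefiningOn {X : Type*} [NormedAddCommGroup X] [NormedSpace ℝ X]
    (Ω V : Set X) (f : X → ℝ) : Prop where
  isOpen : IsOpen V
  contDiffOn : ContDiffOn ℝ 2 f V
  neg : ∀ y ∈ V, y ∈ Ω → f y < 0
  pos : ∀ y ∈ V, y ∉ closure Ω → 0 < f y
  zero : ∀ y ∈ V, y ∈ frontier Ω → f y = 0
  fderiv_ne_zero : ∀ y ∈ V, y ∈ frontier Ω → fderiv ℝ f y ≠ 0

/-! ### First-order behaviour along rays -/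

section Calculus

variable {X : Type*} [NormedAddCommGroup X] [NormedSpace ℝ X]

theorem HasFDerivAt.tendsto_slope_line {f : X → ℝ} {f' : X →L[ℝ] ℝ} {x : X}
    (hf : HasFDerivAt f f' x) (h0 : f x = 0) (v : X) :
    Tendsto (fun t : ℝ => t⁻¹ * f (x + t • v)) (𝓝[>] 0) (𝓝 (f' v)) := by
  have h : HasDerivAt (fun t : ℝ => f (x + t • v)) (f' v) 0 := by
    simpa using! hf.hasLineDerivAt v
  have := h.tendsto_slope.mono_left (nhdsWithin_mono 0 (fun t (ht : 0 < t) => ht.ne'))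
  refine this.congr fun t => ?_
  simp [slope_def_field, h0, div_eq_inv_mul]

theorem tendsto_line_nhdsGT (x v : X) :
    Tendsto (fun t : ℝ => x + t • v) (𝓝[>] 0) (𝓝 x) := by
  have h : Continuous fun t : ℝ => x + t • v := by fun_prop
  simpa using (h.tendsto 0).mono_left nhdsWithin_le_nhds

theorem HasFDerivAt.eventually_pos_line {f : X → ℝ} {f' : X →L[ℝ] ℝ} {x : X}
    (hf : HasFDerivAt f f' x) (h0 : f x = 0) {v : X} (hv : 0 < f' v) :
    ∀ᶠ t : ℝ in 𝓝[>] 0, 0 < f (x + t • v) := by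
  filter_upwards [(hf.tendsto_slope_line h0 v).eventually (lt_mem_nhds hv), self_mem_nhdsWithin]
    with t ht ht0
  have ht0 : 0 < t := ht0
  exact (mul_pos_iff_of_pos_left (inv_pos.2 ht0)).1 ht

/-- A nonzero linear functional that is nonnegative on an open half space is positive on it. -/
theorem pos_of_nonneg_on_halfSpace {φ ψ : X →L[ℝ] ℝ} (hψ : ψ ≠ 0)
    (h : ∀ v, 0 < φ v → 0 ≤ ψ v) {v : X} (hv : 0 < φ v) : 0 < ψ v := by
  refine (h v hv).lt_of_ne' fun h0 => ?_
  obtain ⟨w, hw⟩ : ∃ w, ψ w < 0 := by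
    obtain ⟨w, hw⟩ : ∃ w, ψ w ≠ 0 := by
      by_contra! hc
      exact hψ (ContinuousLinearMap.ext hc)
    rcases hw.lt_or_gt with hw | hw
    · exact ⟨w, hw⟩
    · exact ⟨-w, by simpa using hw⟩
  -- A small push towards `w` stays in the open half space but makes `ψ` negative, since `ψ v = 0`.
  have hev : ∀ᶠ t : ℝ in 𝓝[>] 0, 0 < φ (v + t • w) :=
    ((φ.continuous.tendsto v).comp (tendsto_line_nhdsGT v w)).eventually (lt_mem_nhds hv)
  obtain ⟨t, ht, ht0⟩ := (hev.and self_mem_nhdsWithin).exists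
  have ht0 : 0 < t := ht0
  have := h _ ht
  rw [map_add, map_smul, h0, zero_add, smul_eq_mul] at this
  nlinarith

end Calculus

/-! ### Outward directions of defining functions -/

namespace IsDefiningOn

variable {X : Type*} [NormedAddCommGroup X] [NormedSpace ℝ X] {Ω V W : Set X} {f g : X → ℝ}

theorem contDiffAt (h : IsDefiningOn Ω V f) {x : X} (hx : x ∈ V) : ContDiffAt ℝ 2 f x :=
  h.contDiffOn.contDiffAt (h.isOpen.mem_nhds hx)

theorem hasFDerivAt (h : IsDefiningOn Ω V f) {x : X} (hx : x ∈ V) :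
    HasFDerivAt f (fderiv ℝ f x) x :=
  ((h.contDiffAt hx).differentiableAt (by norm_num)).hasFDerivAt

theorem nonpos_of_mem_closure (h : IsDefiningOn Ω V f) {x : X} (hx : x ∈ V)
    (hxc : x ∈ closure Ω) : f x ≤ 0 := by
  by_cases hxΩ : x ∈ Ω
  · exact (h.neg x hx hxΩ).le
  · exact (h.zero x hx ⟨hxc, fun hi => hxΩ (interior_subset hi)⟩).le

theorem eventually_notMem_closure (h : IsDefiningOn Ω V f) {x : X} (hx : x ∈ V)
    (hxΩ : x ∈ frontier Ω) {v : X} (hv : 0 < fderiv ℝ f x v) :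
    ∀ᶠ t : ℝ in 𝓝[>] 0, x + t • v ∉ closure Ω := by
  filter_upwards [(h.hasFDerivAt hx).eventually_pos_line (h.zero x hx hxΩ) hv,
    (tendsto_line_nhdsGT x v).eventually (h.isOpen.mem_nhds hx)] with t ht htV hc
  exact (h.nonpos_of_mem_closure htV hc).not_gt ht

/-- Two defining functions have the same outward directions. -/
theorem fderiv_pos (hf : IsDefiningOn Ω V f) (hg : IsDefiningOn Ω W g) {x : X} (hV : x ∈ V)
    (hW : x ∈ W) (hx : x ∈ frontier Ω) {v : X} (hv : 0 < fderiv ℝ f x v) :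
    0 < fderiv ℝ g x v := by
  refine pos_of_nonneg_on_halfSpace (hg.fderiv_ne_zero x hW hx) (fun w hw => ?_) hv
  -- The ray along `w` leaves `closure Ω`, because `f` increases along it; off the closure `g > 0`,
  -- so the slopes of `g` are nonnegative.
  refine ge_of_tendsto ((hg.hasFDerivAt hW).tendsto_slope_line (hg.zero x hW hx) w) ?_
  filter_upwards [hf.eventually_notMem_closure hV hx hw, self_mem_nhdsWithin,
    (tendsto_line_nhdsGT x w).eventually (hg.isOpen.mem_nhds hW)] with t ht ht0 htW
  have ht0 : 0 < t := ht0
  exact mul_nonneg (inv_nonneg.2 ht0.le) (hg.pos _ htW ht).le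

theorem exists_fderiv_pos (h : IsDefiningOn Ω V f) {x : X} (hx : x ∈ V) (hxΩ : x ∈ frontier Ω) :
    ∃ v, 0 < fderiv ℝ f x v := by
  obtain ⟨w, hw⟩ : ∃ w, fderiv ℝ f x w ≠ 0 := by
    by_contra! hc
    exact h.fderiv_ne_zero x hx hxΩ (ContinuousLinearMap.ext hc)
  rcases hw.lt_or_gt with hw | hw
  · exact ⟨-w, by simpa using hw⟩
  · exact ⟨w, hw⟩

/-- An outward ray from a boundary point leaves the closure at once, so `Ω` has no slits for the
interior in `shapeSet` to fill. -/
theorem interior_closure_subset (h : IsDefiningOn Ω univ f) (hΩ : IsOpen Ω) :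
    interior (closure Ω) ⊆ Ω := by
  intro x hx
  by_contra hxΩ
  have hxf : x ∈ frontier Ω := by
    rw [hΩ.frontier_eq]
    exact ⟨interior_subset hx, hxΩ⟩
  obtain ⟨v, hv⟩ := h.exists_fderiv_pos (mem_univ x) hxf
  obtain ⟨t, ht, ht'⟩ := ((h.eventually_notMem_closure (mem_univ x) hxf hv).and
    ((tendsto_line_nhdsGT x v).eventually (isOpen_interior.mem_nhds hx))).exists
  exact ht (interior_subset ht')

end IsDefiningOn

/-! ### Gluing defining functions -/

section Gluing

variable {X : Type*} [NormedAddCommGroup X] [NormedSpace ℝ X] {ι : Type*}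

/-- In the product rule, the derivatives of the weights are multiplied by `f i x = 0`. -/
theorem SmoothPartitionOfUnity.hasFDerivAt_finsum_of_eq_zero
    (ρ : SmoothPartitionOfUnity ι 𝓘(ℝ, X) X univ) {f : ι → X → ℝ} {f' : ι → X →L[ℝ] ℝ} {x : X}
    (hf : ∀ i, x ∈ tsupport (ρ i) → HasFDerivAt (f i) (f' i) x ∧ f i x = 0) :
    HasFDerivAt (fun y => ∑ᶠ i, ρ i y • f i y) (∑ᶠ i, ρ i x • f' i) x := by
  have hsum : HasFDerivAt (fun y => ∑ i ∈ ρ.fintsupport x, ρ i y • f i y)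
      (∑ i ∈ ρ.fintsupport x, ρ i x • f' i) x := by
    refine HasFDerivAt.fun_sum fun i hi => ?_
    obtain ⟨hd, h0⟩ := hf i ((ρ.mem_fintsupport_iff x i).1 hi)
    have hρ : HasFDerivAt (ρ i) (fderiv ℝ (ρ i) x) x :=
      (((ρ i).contMDiff.contDiff).differentiable (by simp) x).hasFDerivAt
    have := hρ.smul hd
    rw [h0] at this
    simpa using! this
  have hfin : ∑ᶠ i, ρ i x • f' i = ∑ i ∈ ρ.fintsupport x, ρ i x • f' i := by
    refine finsum_eq_sum_of_support_subset _ fun i hi => ?_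
    refine ρ.finsupport_subset_fintsupport x ((ρ.mem_finsupport x).2 fun h => hi ?_)
    simp [h]
  rw [hfin]
  refine hsum.congr_of_eventuallyEq ?_
  filter_upwards [ρ.eventually_finsupport_subset x] with y hy
  refine finsum_eq_sum_of_support_subset _ fun i hi => hy ((ρ.mem_finsupport y).2 fun h => hi ?_)
  simp [h]

theorem exists_isDefiningOn_univ [FiniteDimensional ℝ X] {Ω : Set X}
    (h : ∀ x, ∃ V f, x ∈ V ∧ IsDefiningOn Ω V f) : ∃ g, IsDefiningOn Ω univ g := by
  choose V f hxV hf using h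
  obtain ⟨ρ, hρ⟩ := SmoothPartitionOfUnity.exists_isSubordinate 𝓘(ℝ, X) isClosed_univ V
    (fun x => (hf x).isOpen) (fun x _ => mem_iUnion_of_mem x (hxV x))
  have hmem : ∀ {i x}, ρ i x ≠ 0 → x ∈ V i := fun h => hρ _ (subset_tsupport _ h)
  refine ⟨fun y => ∑ᶠ i, ρ i y • f i y, isOpen_univ, ?_, ?_, ?_, ?_, ?_⟩
  · refine contDiffOn_univ.2 (contMDiff_iff_contDiff.1 ?_)
    exact ρ.contMDiff_finsum_smul fun i x hx => ((hf i).contDiffAt (hρ i hx)).contMDiffAt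
  · exact fun y _ hy => ρ.finsum_smul_mem_convex (g := f) (t := Iio (0 : ℝ)) (mem_univ y)
      (fun i hi => (hf i).neg y (hmem hi) hy) (convex_Iio 0)
  · exact fun y _ hy => ρ.finsum_smul_mem_convex (g := f) (t := Ioi (0 : ℝ)) (mem_univ y)
      (fun i hi => (hf i).pos y (hmem hi) hy) (convex_Ioi 0)
  · exact fun y _ hy => ρ.finsum_smul_mem_convex (g := f) (t := {(0 : ℝ)}) (mem_univ y)
      (fun i hi => (hf i).zero y (hmem hi) hy) (convex_singleton 0)
  · intro x _ hx
    rw [(ρ.hasFDerivAt_finsum_of_eq_zero fun i hi =>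
      ⟨(hf i).hasFDerivAt (hρ i hi), (hf i).zero x (hρ i hi) hx⟩).fderiv]
    -- A direction outward for one local function is outward for all, and `φ v > 0` is a convex
    -- condition on `φ`.
    obtain ⟨v, hv⟩ := (hf x).exists_fderiv_pos (hxV x) hx
    have hpos : ∑ᶠ i, ρ i x • fderiv ℝ (f i) x ∈ {φ : X →L[ℝ] ℝ | 0 < φ v} := by
      refine ρ.finsum_smul_mem_convex (g := fun i y => fderiv ℝ (f i) y) (mem_univ x)
        (fun i hi => (hf x).fderiv_pos (hf i) (hxV x) (hmem hi) hx hv) ?_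
      exact convex_halfSpace_gt (ContinuousLinearMap.apply ℝ ℝ v).isLinear 0
    intro h0
    simp [h0] at hpos

end Gluing

/-- By the chain rule the derivative of `e` has a right inverse, which supplies a vector sent to the
`i`-th basis vector. -/
theorem OpenPartialHomeomorph.fderiv_coord_ne_zero {n : ℕ}
    {e : OpenPartialHomeomorph (EuclideanSpace ℝ (Fin n)) (EuclideanSpace ℝ (Fin n))}
    {y : EuclideanSpace ℝ (Fin n)} (hy : y ∈ e.source) (he : DifferentiableAt ℝ e y)
    (he' : DifferentiableAt ℝ e.symm (e y)) (i : Fin n) : fderiv ℝ (fun z => e z i) y ≠ 0 := by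
  have hcomp : HasFDerivAt (fun z => e (e.symm z))
      ((fderiv ℝ e y).comp (fderiv ℝ e.symm (e y))) (e y) := by
    refine HasFDerivAt.comp (e y) ?_ he'.hasFDerivAt
    rw [e.left_inv hy]
    exact he.hasFDerivAt
  have hid := hcomp.unique <| (hasFDerivAt_id (e y)).congr_of_eventuallyEq <|
    (e.eventually_right_inverse (e.map_source hy))
  have hcoord : HasFDerivAt (fun z => e z i)
      ((EuclideanSpace.proj i : EuclideanSpace ℝ (Fin n) →L[ℝ] ℝ).comp (fderiv ℝ e y)) y :=
    (EuclideanSpace.proj i : EuclideanSpace ℝ (Fin n) →L[ℝ] ℝ).hasFDerivAt.comp y he.hasFDerivAt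
  intro h0
  rw [hcoord.fderiv] at h0
  have h1 := DFunLike.congr_fun h0 (fderiv ℝ e.symm (e y) (EuclideanSpace.single i 1))
  have h2 := DFunLike.congr_fun hid (EuclideanSpace.single i 1)
  simp only [ContinuousLinearMap.comp_apply, ContinuousLinearMap.id_apply] at h1 h2
  rw [h2] at h1
  simp at h1

theorem IsC2Domain.exists_isDefiningOn {Ω : Set Plane} (hΩ : IsC2Domain Ω) :
    ∃ g, IsDefiningOn Ω univ g := by
  refine exists_isDefiningOn_univ fun x => ?_
  by_cases hxΩ : x ∈ Ω
  · refine ⟨Ω, fun _ => -1, hxΩ, hΩ.1.1, contDiffOn_const, fun _ _ _ => by norm_num,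
      fun y hy hy' => absurd (subset_closure hy) hy', fun y hy hy' => ?_, fun y hy hy' => ?_⟩ <;>
    exact absurd hy (hΩ.1.1.frontier_eq ▸ hy').2
  by_cases hxc : x ∈ closure Ω
  · have hx : x ∈ frontier Ω := hΩ.1.1.frontier_eq ▸ ⟨hxc, hxΩ⟩
    obtain ⟨e, hxe, he, he', hin, hfr⟩ := hΩ.2 x hx
    have hec : ContDiffOn ℝ 2 (fun y => e y 1) e.source := contDiffOn_euclidean.1 he 1
    refine ⟨e.source, fun y => -e y 1, hxe, e.open_source, hec.neg, fun y hy hy' => ?_,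
      fun y hy hy' => ?_, fun y hy hy' => ?_, fun y hy hy' => ?_⟩
    · exact neg_lt_zero.2 ((hin y hy).1 hy')
    · refine neg_pos.2 (lt_of_le_of_ne (not_lt.1 fun h => hy' ?_) fun h => hy' ?_)
      · exact subset_closure ((hin y hy).2 h)
      · exact frontier_subset_closure ((hfr y hy).2 h)
    · simp [(hfr y hy).1 hy']
    · rw [fderiv_fun_neg, neg_ne_zero]
      refine e.fderiv_coord_ne_zero hy ?_ ?_ 1
      · exact (he.contDiffAt (e.open_source.mem_nhds hy)).differentiableAt (by norm_num)
      · exact (he'.contDiffAt (e.open_target.mem_nhds (e.map_source hy))).differentiableAt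
          (by norm_num)
  · refine ⟨(closure Ω)ᶜ, fun _ => 1, hxc, isClosed_closure.isOpen_compl, contDiffOn_const,
      fun y hy hy' => absurd (subset_closure hy') hy, fun _ _ _ => by norm_num,
      fun y hy hy' => ?_, fun y hy hy' => ?_⟩ <;>
    exact absurd (frontier_subset_closure hy') hy


/-! ### Flattening a regular level set -/

/-- A nonzero linear functional on the plane is the second component of a linear automorphism. -/
theorem exists_continuousLinearEquiv_coord_one_eq {φ : Plane →L[ℝ] ℝ} (hφ : φ ≠ 0) :
    ∃ A : Plane ≃L[ℝ] Plane, ∀ v, A v 1 = φ v := by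
  obtain ⟨ψ, hψ⟩ : ∃ ψ : Plane →ₗ[ℝ] ℝ, ∀ v, φ v = 0 → ψ v = 0 → v = 0 := by
    set a := φ (EuclideanSpace.single 0 1) with ha
    set b := φ (EuclideanSpace.single 1 1) with hb
    have hφv : ∀ v : Plane, φ v = v 0 * a + v 1 * b := by
      intro v
      have hv : v = v 0 • EuclideanSpace.single 0 1 + v 1 • EuclideanSpace.single 1 1 := by
        ext i
        fin_cases i <;> simp
      conv_lhs => rw [hv]
      simp [ha, hb]
    have hab : 0 < a ^ 2 + b ^ 2 := by
      refine lt_of_le_of_ne (by positivity) fun h => hφ (ContinuousLinearMap.ext fun v => ?_)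
      have h1 : a = 0 := by nlinarith [sq_nonneg a, sq_nonneg b]
      have h2 : b = 0 := by nlinarith [sq_nonneg a, sq_nonneg b]
      simp [hφv, h1, h2]
    refine ⟨a • (EuclideanSpace.proj 1 : Plane →L[ℝ] ℝ).toLinearMap -
      b • (EuclideanSpace.proj 0 : Plane →L[ℝ] ℝ).toLinearMap, fun v h1 h2 => ?_⟩
    rw [hφv] at h1
    have h2 : a * v 1 - b * v 0 = 0 := by simpa using h2
    have h3 : v 0 = 0 := (mul_eq_zero.1 (by linear_combination a * h1 - b * h2 :
      (a ^ 2 + b ^ 2) * v 0 = 0)).resolve_left hab.ne'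
    have h4 : v 1 = 0 := (mul_eq_zero.1 (by linear_combination b * h1 + a * h2 :
      (a ^ 2 + b ^ 2) * v 1 = 0)).resolve_left hab.ne'
    ext i
    fin_cases i
    · exact h3
    · exact h4
  let T : Plane →ₗ[ℝ] Plane := (WithLp.linearEquiv 2 ℝ (Fin 2 → ℝ)).symm.toLinearMap ∘ₗ
    LinearMap.pi ![ψ, φ.toLinearMap]
  have hT0 : ∀ v, T v 0 = ψ v := fun v => rfl
  have hT1 : ∀ v, T v 1 = φ v := fun v => rfl
  have hinj : Function.Injective T := by
    rw [← LinearMap.ker_eq_bot, LinearMap.ker_eq_bot']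
    intro v hv
    exact hψ v (by rw [← hT1, hv]; rfl) (by rw [← hT0, hv]; rfl)
  exact ⟨(LinearEquiv.ofInjectiveEndo T hinj).toContinuousLinearEquiv, hT1⟩

/-- A `C²` function with nonzero derivative at `x` is the second coordinate of a `C²`
diffeomorphism from a small neighborhood of `x` onto a ball. -/
theorem exists_flattening {f : Plane → ℝ} {D : Set Plane} (hD : IsOpen D)
    (hf : ContDiffOn ℝ 2 f D) {x : Plane} (hx : x ∈ D) (hf' : fderiv ℝ f x ≠ 0) :
    ∃ e : OpenPartialHomeomorph Plane Plane, x ∈ e.source ∧ e.source ⊆ D ∧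
      ContDiffOn ℝ 2 e e.source ∧ ContDiffOn ℝ 2 e.symm e.target ∧
      Convex ℝ e.target ∧ ∀ y, e y 1 = f y := by
  obtain ⟨A, hA⟩ := exists_continuousLinearEquiv_coord_one_eq hf'
  -- The correction turns the second coordinate of `A` into `f` itself; its derivative vanishes at
  -- `x`, so `F` has derivative `A` there.
  let F : Plane → Plane := fun y => A y + (f y - fderiv ℝ f x y) • EuclideanSpace.single 1 1
  have hF1 : ∀ y, F y 1 = f y := fun y => by simp [F, hA]
  have hFD : ContDiffOn ℝ 2 F D :=
    A.contDiff.contDiffOn.add ((hf.sub (fderiv ℝ f x).contDiff.contDiffOn).smul contDiffOn_const)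
  have hFx : ContDiffAt ℝ 2 F x := hFD.contDiffAt (hD.mem_nhds hx)
  have hfx : HasFDerivAt f (fderiv ℝ f x) x :=
    ((hf.contDiffAt (hD.mem_nhds hx)).differentiableAt (by norm_num)).hasFDerivAt
  have hF' : HasFDerivAt F (A : Plane →L[ℝ] Plane) x := by
    have h := (A : Plane →L[ℝ] Plane).hasFDerivAt.add
      ((hfx.sub (fderiv ℝ f x).hasFDerivAt).smul_const (EuclideanSpace.single (1 : Fin 2) (1 : ℝ)))
      (x := x)
    simpa using! h
  let e := hFx.toOpenPartialHomeomorph F hF' (by norm_num)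
  have hxe : x ∈ e.source := hFx.mem_toOpenPartialHomeomorph_source hF' (by norm_num)
  have hsymm : ContDiffAt ℝ 2 e.symm (e x) := hFx.to_localInverse hF' (by norm_num)
  have hDn : e.symm ⁻¹' D ∈ 𝓝 (e x) := by
    refine (e.continuousAt_symm (e.map_source hxe)).preimage_mem_nhds ?_
    rw [e.left_inv hxe]
    exact hD.mem_nhds hx
  obtain ⟨r, hr, hball⟩ := Metric.mem_nhds_iff.1 (inter_mem (inter_mem
    (e.open_target.mem_nhds (e.map_source hxe)) hDn) (hsymm.eventually (by simp)))
  let e' := (e.symm.restrOpen (Metric.ball (e x) r) Metric.isOpen_ball).symm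
  have htarget : e'.target = Metric.ball (e x) r :=
    inter_eq_right.2 fun z hz => (hball hz).1.1
  have hsource : e'.source ⊆ D := by
    intro y hy
    have h1 : e' y ∈ e'.target := e'.map_source hy
    rw [htarget] at h1
    have h2 : e'.symm (e' y) ∈ D := (hball h1).1.2
    rwa [e'.left_inv hy] at h2
  refine ⟨e', ?_, hsource, hFD.mono hsource, ?_, ?_, hF1⟩
  · have h1 : e x ∈ e'.target := htarget ▸ Metric.mem_ball_self hr
    have h2 : e'.symm (e x) ∈ e'.source := e'.map_target h1
    rwa [show e'.symm (e x) = x from e.left_inv hxe] at h2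
  · rw [htarget]
    intro z hz
    have h : ContDiffAt ℝ 2 e.symm z := (hball hz).2
    exact h.contDiffWithinAt
  · rw [htarget]
    exact convex_ball _ _

/-- Moving from `e y` by `t * c` along the `i`-th axis gives `c * e z i = t * c²`; the sign of `c`
selects the side. -/
theorem OpenPartialHomeomorph.mem_closure_of_coord_eq_zero {Y : Type*} [TopologicalSpace Y] {n : ℕ}
    (e : OpenPartialHomeomorph Y (EuclideanSpace ℝ (Fin n))) {y : Y} (hy : y ∈ e.source) {i : Fin n}
    (h0 : e y i = 0) {c : ℝ} (hc : c ≠ 0) : y ∈ closure {z ∈ e.source | 0 < c * e z i} := by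
  have hline := tendsto_line_nhdsGT (e y) (EuclideanSpace.single i c)
  have hlim : Tendsto (fun t : ℝ => e.symm (e y + t • EuclideanSpace.single i c))
      (𝓝[>] 0) (𝓝 y) := by
    have := (e.continuousAt_symm (e.map_source hy)).tendsto.comp hline
    rwa [e.left_inv hy] at this
  refine mem_closure_of_tendsto hlim ?_
  filter_upwards [hline.eventually (e.open_target.mem_nhds (e.map_source hy)),
    self_mem_nhdsWithin] with t ht ht0
  have ht0 : 0 < t := ht0
  refine ⟨e.map_target ht, ?_⟩
  have hcc : 0 < c * c := mul_self_pos.2 hc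
  rw [e.right_inv ht]
  simp only [PiLp.add_apply, h0, PiLp.smul_apply, PiLp.single_apply, if_true,
    smul_eq_mul, zero_add]
  calc 0 < t * (c * c) := mul_pos ht0 hcc
    _ = c * (t * c) := by ring

theorem IsOpen.notMem_of_mem_frontier_connectedComponentIn {Y : Type*} [TopologicalSpace Y]
    [LocallyConnectedSpace Y] {S : Set Y} (hS : IsOpen S) {x y : Y}
    (hy : y ∈ frontier (connectedComponentIn S x)) : y ∉ S := by
  intro hyS
  have hx := hS.connectedComponentIn (x := x)
  rw [hx.frontier_eq] at hy
  obtain ⟨z, hzy, hzx⟩ := mem_closure_iff.1 hy.1 _ (hS.connectedComponentIn (x := y))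
    (mem_connectedComponentIn hyS)
  refine hy.2 ?_
  rw [connectedComponentIn_eq hzx, ← connectedComponentIn_eq hzy]
  exact mem_connectedComponentIn hyS

/-! ### Components of the shape set -/

theorem shapeSet_subset {D : Set Plane} {g : Plane → ℝ} : shapeSet D g ⊆ {x | x ∈ D ∧ g x ≤ 0} :=
  interior_subset

theorem mem_shapeSet_of_neg {D : Set Plane} {g : Plane → ℝ} (hD : IsOpen D)
    (hg : ContinuousOn g D) {x : Plane} (hx : x ∈ D) (hgx : g x < 0) : x ∈ shapeSet D g :=
  mem_interior.2 ⟨D ∩ g ⁻¹' Iio 0, fun _ hy => ⟨hy.1, hy.2.le⟩,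
    hg.isOpen_inter_preimage hD isOpen_Iio, hx, hgx⟩

theorem frontier_component_shapeSet {D : Set Plane} {g : Plane → ℝ} (hD : IsOpen D)
    (hg : ContinuousOn g (closure D)) (hpos : ∀ x ∈ frontier D, 0 < g x) {p x : Plane}
    (hx : x ∈ frontier (connectedComponentIn (shapeSet D g) p)) : x ∈ D ∧ g x = 0 := by
  have hsub : connectedComponentIn (shapeSet D g) p ⊆ {x | x ∈ D ∧ g x ≤ 0} :=
    (connectedComponentIn_subset _ _).trans shapeSet_subset
  have hxD : x ∈ closure D := closure_mono (fun y hy => (hsub hy).1) (frontier_subset_closure hx)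
  have hgx : g x ≤ 0 := by
    refine ContinuousWithinAt.closure_le (frontier_subset_closure hx)
      ((hg x hxD).mono fun y hy => subset_closure (hsub hy).1) continuousWithinAt_const
      fun y hy => (hsub hy).2
  have hxD' : x ∈ D := by
    by_contra h
    exact (hpos x (hD.frontier_eq ▸ ⟨hxD, h⟩)).not_ge hgx
  refine ⟨hxD', hgx.eq_of_not_lt fun hlt => ?_⟩
  exact isOpen_interior.notMem_of_mem_frontier_connectedComponentIn hx
    (mem_shapeSet_of_neg hD (hg.mono subset_closure) hxD' hlt)

theorem isC2Domain_component_shapeSet {D : Set Plane} {g : Plane → ℝ} (hD : IsOpen D)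
    (hg : ContinuousOn g (closure D)) (hg2 : ContDiffOn ℝ 2 g D)
    (hreg : ∀ x ∈ D, 0 < ‖gradient g x‖ + |g x|) (hpos : ∀ x ∈ frontier D, 0 < g x) {p : Plane}
    (hp : p ∈ shapeSet D g) : IsC2Domain (connectedComponentIn (shapeSet D g) p) := by
  set Ω := connectedComponentIn (shapeSet D g) p with hΩ
  have hΩo : IsOpen Ω := isOpen_interior.connectedComponentIn
  refine ⟨⟨hΩo, isConnected_connectedComponentIn_iff.2 hp⟩, fun x hx => ?_⟩
  obtain ⟨hxD, hgx⟩ := frontier_component_shapeSet hD hg hpos hx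
  have hd : fderiv ℝ (fun y => -g y) x ≠ 0 := by
    have h := hreg x hxD
    rw [hgx, abs_zero, add_zero, norm_pos_iff] at h
    rw [fderiv_fun_neg, neg_ne_zero]
    intro h0
    exact h (by simp [gradient, h0])
  obtain ⟨e, hxe, heD, he, he', hconv, heg⟩ := exists_flattening hD hg2.neg hxD hd
  -- Connectedness of the negative side prevents a second component from entering the chart.
  have hneg_pre : IsPreconnected {y ∈ e.source | 0 < e y 1} := by
    have hc : Convex ℝ (e.target ∩ {z : Plane | 0 < z 1}) :=
      hconv.inter (convex_halfSpace_gt (EuclideanSpace.proj (𝕜 := ℝ) (1 : Fin 2)).isLinear 0)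
    have himg : e.symm '' (e.target ∩ {z : Plane | 0 < z 1}) = {y ∈ e.source | 0 < e y 1} := by
      ext y
      constructor
      · rintro ⟨z, ⟨hz, hz1⟩, rfl⟩
        exact ⟨e.map_target hz, by rwa [e.right_inv hz]⟩
      · rintro ⟨hy, hy1⟩
        exact ⟨e y, ⟨e.map_source hy, hy1⟩, e.left_inv hy⟩
    rw [← himg]
    exact hc.isPreconnected.image _ (e.continuousOn_symm.mono inter_subset_left)
  have hsub : {y ∈ e.source | 0 < e y 1} ⊆ shapeSet D g := fun y hy =>
    mem_shapeSet_of_neg hD (hg.mono subset_closure) (heD hy.1) (by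
      have := hy.2
      rw [heg] at this
      exact neg_pos.1 this)
  have hshape : ∀ y ∈ e.source, y ∈ shapeSet D g → 0 < e y 1 := by
    intro y hy hyS
    refine lt_of_le_of_ne ?_ fun h0 => ?_
    · rw [heg]
      exact neg_nonneg.2 (shapeSet_subset hyS).2
    -- A zero of `g` in the chart is a limit of points with `g > 0`, so it is not interior to `g ≤
    -- 0`.
    · obtain ⟨z, hzS, hz⟩ := mem_closure_iff.1
        (e.mem_closure_of_coord_eq_zero hy h0.symm (c := -1) (by norm_num)) _ isOpen_interior hyS
      have h1 := hz.2
      have h2 : g z ≤ 0 := (shapeSet_subset hzS).2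
      rw [heg] at h1
      linarith
  have hΩ_iff : ∀ y ∈ e.source, y ∈ Ω ↔ 0 < e y 1 := by
    obtain ⟨q, hqe, hqΩ⟩ := mem_closure_iff.1 (frontier_subset_closure hx) _ e.open_source hxe
    have hq : 0 < e q 1 := hshape q hqe (connectedComponentIn_subset _ _ hqΩ)
    intro y hy
    refine ⟨fun h => hshape y hy (connectedComponentIn_subset _ _ h), fun h => ?_⟩
    rw [hΩ, connectedComponentIn_eq hqΩ]
    exact hneg_pre.subset_connectedComponentIn ⟨hqe, hq⟩ hsub ⟨hy, h⟩
  refine ⟨e, hxe, he, he', hΩ_iff, fun y hy => ⟨fun h => ?_, fun h => ?_⟩⟩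
  · rw [heg, (frontier_component_shapeSet hD hg hpos h).2, neg_zero]
  · rw [hΩo.frontier_eq]
    refine ⟨closure_mono (fun z hz => ?_)
      (e.mem_closure_of_coord_eq_zero hy h one_ne_zero), fun hyΩ => ?_⟩
    · exact (hΩ_iff z hz.1).2 (by simpa using hz.2)
    · exact ((hΩ_iff y hy).1 hyΩ).ne' h

/-! ### From a defining function to a shape function -/

theorem ContDiff.isC2OnClosure {g : Plane → ℝ} (hg : ContDiff ℝ 2 g) (D : Set Plane) :
    IsC2OnClosure D g :=
  ⟨hg.continuous.continuousOn, hg.contDiffOn, fun k hk => ⟨iteratedFDeriv ℝ k g,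
    (hg.continuous_iteratedFDeriv (by exact_mod_cast hk)).continuousOn, fun _ _ => rfl⟩⟩

theorem IsDefiningOn.mem_admissibleShapeFunctions {D E Ω : Set Plane} {g : Plane → ℝ}
    (h : IsDefiningOn Ω univ g) (hΩ : IsOpen Ω) (hE : E ⊆ Ω)
    (hD : Disjoint (closure Ω) (frontier D)) : g ∈ admissibleShapeFunctions D E := by
  refine ⟨(contDiffOn_univ.1 h.contDiffOn).isC2OnClosure D, fun x hx => h.neg x (mem_univ x) (hE hx),
    fun x _ => ?_, fun x hx => h.pos x (mem_univ x) fun hc => disjoint_left.1 hD hc hx⟩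
  by_cases hx : x ∈ frontier Ω
  · refine add_pos_of_pos_of_nonneg (norm_pos_iff.2 fun h0 => ?_) (abs_nonneg _)
    exact h.fderiv_ne_zero x (mem_univ x) hx (by simpa [gradient] using h0)
  · refine add_pos_of_nonneg_of_pos (norm_nonneg _) (abs_pos.2 ?_)
    by_cases hxΩ : x ∈ Ω
    · exact (h.neg x (mem_univ x) hxΩ).ne
    · refine (h.pos x (mem_univ x) fun hc => hx ?_).ne'
      exact hΩ.frontier_eq ▸ ⟨hc, hxΩ⟩

theorem IsDefiningOn.shapeSet_eq {D Ω : Set Plane} {g : Plane → ℝ} (h : IsDefiningOn Ω univ g)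
    (hΩ : IsOpen Ω) (hD : Ω ⊆ D) : shapeSet D g = Ω := by
  refine Subset.antisymm (fun x hx => h.interior_closure_subset hΩ ?_) (interior_maximal ?_ hΩ)
  · refine interior_mono (fun y hy => ?_) hx
    by_contra hc
    exact (h.pos y (mem_univ y) hc).not_ge hy.2
  · exact fun x hx => ⟨hD hx, (h.neg x (mem_univ x) hx).le⟩

theorem proposition2p5 (D E : Set Plane)
    (hD : IsC11Domain D) (hDb : Bornology.IsBounded D)
    (hE : IsDomainSet E) (hED : E ⊆ D)
    (hdist : ∃ δ : ℝ, 0 < δ ∧ ∀ x ∈ closure E, ∀ y ∈ frontier D, δ ≤ dist x y) :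
    admissibleDomains D E =
      {Ω : Set Plane | Ω ⊆ D ∧ IsC2Domain Ω ∧ E ⊆ Ω ∧ frontier Ω ∩ frontier D = ∅} := by
  have hDo : IsOpen D := hD.1.1
  ext Ω
  constructor
  · rintro ⟨g, ⟨⟨hg, hg2, -⟩, -, hreg, hpos⟩, ⟨p, hp, rfl⟩, hEΩ⟩
    refine ⟨fun x hx => (shapeSet_subset (connectedComponentIn_subset _ _ hx)).1,
      isC2Domain_component_shapeSet hDo hg hg2 hreg hpos hp, hEΩ, ?_⟩
    refine eq_empty_of_forall_notMem fun x hx => ?_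
    exact (hDo.frontier_eq ▸ hx.2).2 (frontier_component_shapeSet hDo hg hpos hx.1).1
  · rintro ⟨hΩD, hΩ, hEΩ, hfr⟩
    obtain ⟨g, hg⟩ := hΩ.exists_isDefiningOn
    have hdisj : Disjoint (closure Ω) (frontier D) := by
      refine disjoint_left.2 fun x hx hxD => ?_
      by_cases hxΩ : x ∈ Ω
      · exact (hDo.frontier_eq ▸ hxD).2 (hΩD hxΩ)
      · exact eq_empty_iff_forall_notMem.1 hfr x ⟨hΩ.1.1.frontier_eq ▸ ⟨hx, hxΩ⟩, hxD⟩
    obtain ⟨p, hp⟩ := hΩ.1.2.nonempty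
    have hshape := hg.shapeSet_eq hΩ.1.1 hΩD
    refine ⟨g, hg.mem_admissibleShapeFunctions hΩ.1.1 hEΩ hdisj, ⟨p, hshape ▸ hp, ?_⟩, hEΩ⟩
    rw [hshape, hΩ.1.2.isPreconnected.connectedComponentIn hp]
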